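/- Let $a\in\mathbb R$, let $\psi:\mathbb R\to\,]a,+\infty]$ be $2\pi$-periodic and lower semicontinuous, and let $\Omega=\{(\theta,r)\in\mathbb R^2 : a<r<\psi(\theta)\}$. Let $S(\theta,r)=(F(\theta,r),G(\theta,r))$ be a map of class $C^2$ from $\Omega$ to $\mathbb R^2$ such that $$F(\theta+2\pi,r)=F(\theta,r)+2\pi,\qquad G(\theta+2\pi,r)=G(\theta,r)\qquad\text{for }(\theta,r)\in\Omega,$$ and such that for every $\theta$ the limit $F(\theta,a):=\lim_{r\to a^+}F(\theta,r)$ exists in $\mathbb R$. Assume that $S$ is exact symplectic, i.e. there is $V\in C^3(\Omega)$, $2\pi$-periodic in $\theta$, with $dV=G\,dF-r\,d\theta$ on $\Omega$, and that $S$ satisfies the twist condition $\partial F/\partial r>0$ on $\Omega$. Let $N\in\mathbb Z$ and assume that for every $\theta\in\mathbb R$ there is $r_\theta\in\,]a,\psi(\theta)[$ with $$F(\theta,a)<\theta+2N\pi<F(\theta,r_\theta).$$ Let $(\hat\theta,\hat r)$ be an isolated point of the set of solutions $(\theta,r)\in\Omega$ of the system $$F(\theta,r)=\theta+2N\pi,\qquad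 G(\theta,r)=r,$$ and let $T(\theta,r)=(\theta+2\pi,r)$. Then the fixed-point index $i(T^{-N}S,(\hat\theta,\hat r))$, that is, the Brouwer degree at $0$ of $T^{-N}S-\mathrm{Id}$ on the disc $B_\delta(\hat\theta,\hat r)$ for all sufficiently small $\delta>0$ (the number of turns of $T^{-N}S-\mathrm{Id}$ around the origin along the circle $\partial B_\delta(\hat\theta,\hat r)$), is well defined, and it is equal to $-1$, $0$ or $1$. -/

import Mathlib

open Set Filter Topology

noncomputable section

/-- The open region `{(θ, r) : a < r < ψ θ}`; the upper boundary `ψ` may take the value `+∞`. -/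
def region (a : ℝ) (ψ : ℝ → EReal) : Set (ℝ × ℝ) :=
  {p | a < p.2 ∧ (p.2 : EReal) < ψ p.1}

/-- The map `(θ, r) ↦ (F (θ, r), G (θ, r))` is the lift of a map of the cylinder:
`F (θ + 2π, r) = F (θ, r) + 2π` and `G (θ + 2π, r) = G (θ, r)` on `Ω`. -/
def IsCylinderLift (Ω : Set (ℝ × ℝ)) (F G : ℝ × ℝ → ℝ) : Prop :=
  ∀ p ∈ Ω, F (p.1 + 2 * Real.pi, p.2) = F p + 2 * Real.pi ∧
    G (p.1 + 2 * Real.pi, p.2) = G p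

/-- Exact symplectic: there is `V` of class `C³` on `Ω`, `2π`-periodic in `θ`, with
`dV = r₁ dθ₁ - r dθ` on `Ω`, where `θ₁ = F (θ, r)` and `r₁ = G (θ, r)`. -/
def IsExactSymplectic (Ω : Set (ℝ × ℝ)) (F G : ℝ × ℝ → ℝ) : Prop :=
  ∃ V : ℝ × ℝ → ℝ, ContDiffOn ℝ 3 V Ω ∧
    (∀ p ∈ Ω, fderiv ℝ V p = G p • fderiv ℝ F p - p.2 • ContinuousLinearMap.fst ℝ ℝ ℝ) ∧
    ∀ p ∈ Ω, V (p.1 + 2 * Real.pi, p.2) = V p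

/-- The twist condition `∂θ₁/∂r > 0` on `Ω`. -/
def IsTwist (Ω : Set (ℝ × ℝ)) (F : ℝ × ℝ → ℝ) : Prop :=
  ∀ p ∈ Ω, 0 < deriv (fun r : ℝ => F (p.1, r)) p.2

/-- The solutions in `Ω` of the system `F (θ, r) = θ + 2Nπ`, `G (θ, r) = r`. -/
def solutionSet (Ω : Set (ℝ × ℝ)) (F G : ℝ × ℝ → ℝ) (N : ℤ) : Set (ℝ × ℝ) :=
  {p | p ∈ Ω ∧ F p = p.1 + 2 * N * Real.pi ∧ G p = p.2}

/-- `p` is an isolated point of the set `A` of the plane. -/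
def IsIsolatedPointOf (A : Set (ℝ × ℝ)) (p : ℝ × ℝ) : Prop :=
  p ∈ A ∧ ∃ ε > 0, ∀ q ∈ A, dist q p < ε → q = p

/-- The translation `T (θ, r) = (θ + 2π, r)`, as an element of the group of bijections of the
plane, so that `T ^ (-N)` makes sense for every integer `N`. -/
def translationT : Equiv.Perm (ℝ × ℝ) :=
  Equiv.addRight ((2 * Real.pi, 0) : ℝ × ℝ)

/-- The closed Euclidean disc with centre `p` and radius `δ`. -/
def closedDisc (p : ℝ × ℝ) (δ : ℝ) : Set (ℝ × ℝ) :=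
  {q | (q.1 - p.1) ^ 2 + (q.2 - p.2) ^ 2 ≤ δ ^ 2}

/-- `d` is the (Brouwer) degree at `0` of the planar map `f` on the disc `B_δ(p)`: `f` is
continuous on the closed disc, has no zero on its boundary circle, and `d` is the number of turns
around the origin that `f` makes when the circle is run through once counterclockwise, that is, the
degree of the circle map `f / |f|`. Here `ρ` and `α` are the modulus and a continuous choice of the
argument of `f` along the circle. -/
def HasDiscDegree (f : ℝ × ℝ → ℝ × ℝ) (p : ℝ × ℝ) (δ : ℝ) (d : ℤ) : Prop :=
  ContinuousOn f (closedDisc p δ) ∧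
  ∃ ρ α : ℝ → ℝ, ContinuousOn α (Icc 0 (2 * Real.pi)) ∧
    (∀ t ∈ Icc 0 (2 * Real.pi), 0 < ρ t ∧
      f (p.1 + δ * Real.cos t, p.2 + δ * Real.sin t) =
        (ρ t * Real.cos (α t), ρ t * Real.sin (α t))) ∧
    α (2 * Real.pi) - α 0 = 2 * Real.pi * d

/-- `d` is the fixed-point index `i(f, p)` of `f` at its isolated fixed point `p`: for all
sufficiently small `δ > 0`, `p` is the only fixed point of `f` in the closed disc of radius `δ`
about `p`, and `d = deg (f - Id, B_δ(p))`. -/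
def HasFixedPointIndex (f : ℝ × ℝ → ℝ × ℝ) (p : ℝ × ℝ) (d : ℤ) : Prop :=
  f p = p ∧ ∀ᶠ δ in 𝓝[>] (0 : ℝ),
    (∀ q ∈ closedDisc p δ, f q = q → q = p) ∧ HasDiscDegree (fun q => f q - q) p δ d

end

/-! Put `f = T⁻ᴺS - Id`. The twist condition makes the first component of `f` strictly increasing in
`r`, so near the fixed point `p` its zeros form the graph of a continuous function, with negative
values below and positive values above. The second component vanishes on this graph only at `p`,
because `p` is isolated; hence it has constant signs `sL` and `sR` on the graph to the left and to
the right of `p`. On the right half of a small circle `f` thus avoids the ray through `(0, -sR)`, on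
the left half the ray through `(0, -sL)`. Following the argument with the matching branch on each
half gives the degree `(sL - sR) / 2`, which is `-1`, `0` or `1`. This is `hasDiscDegree_of_signs`;
`exists_eventually_hasDiscDegree` supplies the graph and the signs, and `HasDiscDegree.unique` makes
the index well defined. -/

/-! ### Two branches of the argument -/

/-- The argument of `(x, y)`, chosen continuously off the ray from the origin through `(0, -s)`,
for `s = 1` or `s = -1`. -/
noncomputable def slitArg (s : ℤ) (q : ℝ × ℝ) : ℝ :=
  Complex.arg ⟨s * q.2, -(s * q.1)⟩ + s * (Real.pi / 2)

/-- The complex number is `-s * i * (x + i * y)`: this rotation carries the excluded ray to the cut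
of `Complex.arg`, and the added `s * (π / 2)` undoes it. -/
theorem norm_mul_cos_sin_slitArg {s : ℤ} (hs : s = 1 ∨ s = -1) (q : ℝ × ℝ) :
    ‖(⟨s * q.2, -(s * q.1)⟩ : ℂ)‖ * Real.cos (slitArg s q) = q.1 ∧
      ‖(⟨s * q.2, -(s * q.1)⟩ : ℂ)‖ * Real.sin (slitArg s q) = q.2 := by
  have hc := Complex.norm_mul_cos_arg (⟨s * q.2, -(s * q.1)⟩ : ℂ)
  have hn := Complex.norm_mul_sin_arg (⟨s * q.2, -(s * q.1)⟩ : ℂ)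
  rcases hs with rfl | rfl <;> simp only [slitArg] <;> push_cast at hc hn ⊢
  · rw [one_mul (Real.pi / 2), Real.cos_add_pi_div_two, Real.sin_add_pi_div_two]
    constructor <;> linarith
  · rw [neg_one_mul (Real.pi / 2), ← sub_eq_add_neg, Real.cos_sub_pi_div_two,
      Real.sin_sub_pi_div_two]
    constructor <;> linarith

theorem slitArg_of_pos {s s' : ℤ} (hs : s = 1 ∨ s = -1) (hs' : s' = 1 ∨ s' = -1)
    {q : ℝ × ℝ} (hq : 0 < q.1) : slitArg s q = slitArg s' q := by
  have h : slitArg 1 q = slitArg (-1) q := by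
    have := Complex.arg_neg_eq_arg_sub_pi_of_im_pos (x := (⟨-q.2, q.1⟩ : ℂ)) hq
    have e : -(⟨-q.2, q.1⟩ : ℂ) = ⟨q.2, -q.1⟩ := by apply Complex.ext <;> simp
    rw [e] at this
    simp [slitArg, this]
    ring
  rcases hs with rfl | rfl <;> rcases hs' with rfl | rfl <;> simp [h]

/-- The branch for `1` takes values in `(π / 2, 3 * π / 2)` on the left half-plane, the branch for
`-1` in `(-3 * π / 2, -π / 2)`: they differ by a full turn. -/
theorem slitArg_of_neg {s s' : ℤ} (hs : s = 1 ∨ s = -1) (hs' : s' = 1 ∨ s' = -1)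
    {q : ℝ × ℝ} (hq : q.1 < 0) :
    slitArg s q - slitArg s' q = (s - s') * Real.pi := by
  have h : slitArg 1 q = slitArg (-1) q + 2 * Real.pi := by
    have := Complex.arg_neg_eq_arg_add_pi_of_im_neg (x := (⟨-q.2, q.1⟩ : ℂ)) hq
    have e : -(⟨-q.2, q.1⟩ : ℂ) = ⟨q.2, -q.1⟩ := by apply Complex.ext <;> simp
    rw [e] at this
    simp [slitArg, this]
    ring
  rcases hs with rfl | rfl <;> rcases hs' with rfl | rfl <;> push_cast <;> linarith

theorem continuousAt_slitArg {s : ℤ} (hs : s = 1 ∨ s = -1) {q : ℝ × ℝ}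
    (hq : q.1 = 0 → 0 < s * q.2) : ContinuousAt (slitArg s) q := by
  have hmem : (⟨s * q.2, -(s * q.1)⟩ : ℂ) ∈ Complex.slitPlane := by
    rw [Complex.mem_slitPlane_iff]
    by_cases h : q.1 = 0
    · exact Or.inl (hq h)
    · right
      rcases hs with rfl | rfl <;> simpa using h
  have hmk : Continuous fun q : ℝ × ℝ => (⟨s * q.2, -(s * q.1)⟩ : ℂ) := by
    have : (fun q : ℝ × ℝ => (⟨s * q.2, -(s * q.1)⟩ : ℂ)) =
        fun q => Complex.equivRealProdCLM.symm (s * q.2, -(s * q.1)) := by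
      funext q; apply Complex.ext <;> simp
    rw [this]
    fun_prop
  exact ((Complex.continuousAt_arg hmem).comp (f := fun q : ℝ × ℝ =>
    (⟨s * q.2, -(s * q.1)⟩ : ℂ)) hmk.continuousAt).add continuousAt_const

theorem continuousOn_slitArg_comp {s : ℤ} (hs : s = 1 ∨ s = -1) {γ : ℝ → ℝ × ℝ} {I : Set ℝ}
    (hγ : ContinuousOn γ I) (h : ∀ t ∈ I, (γ t).1 = 0 → 0 < s * (γ t).2) :
    ContinuousOn (fun t => slitArg s (γ t)) I := fun t ht =>
  (continuousAt_slitArg hs (h t ht)).comp_continuousWithinAt (hγ t ht)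

theorem circle_mem_closedDisc (p : ℝ × ℝ) (δ t : ℝ) :
    (p.1 + δ * Real.cos t, p.2 + δ * Real.sin t) ∈ closedDisc p δ := by
  have : (p.1 + δ * Real.cos t - p.1) ^ 2 + (p.2 + δ * Real.sin t - p.2) ^ 2 = δ ^ 2 := by
    linear_combination δ ^ 2 * Real.sin_sq_add_cos_sq t
  exact this.le

/-! ### Degree from signs, and its uniqueness -/

/-- If the first component of `f` changes from negative to positive along the vertical diameter,
and the second component has a constant sign at the zeros of the first one on either side of it,
then the degree of `f` is half the difference of these signs. -/
theorem hasDiscDegree_of_signs {f : ℝ × ℝ → ℝ × ℝ} {p : ℝ × ℝ} {δ : ℝ} (hδ : 0 < δ)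
    {sL sR d : ℤ} (hL : sL = 1 ∨ sL = -1) (hR : sR = 1 ∨ sR = -1) (hd : 2 * d = sL - sR)
    (hf : ContinuousOn f (closedDisc p δ))
    (hr : ∀ q ∈ closedDisc p δ, p.1 < q.1 → (f q).1 = 0 → 0 < sR * (f q).2)
    (hl : ∀ q ∈ closedDisc p δ, q.1 < p.1 → (f q).1 = 0 → 0 < sL * (f q).2)
    (ht : ∀ q ∈ closedDisc p δ, q.1 = p.1 → p.2 < q.2 → 0 < (f q).1)
    (hb : ∀ q ∈ closedDisc p δ, q.1 = p.1 → q.2 < p.2 → (f q).1 < 0) :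
    HasDiscDegree f p δ d := by
  have hπ := Real.pi_pos
  refine ⟨hf, ?_⟩
  set c : ℝ → ℝ × ℝ := fun t => (p.1 + δ * Real.cos t, p.2 + δ * Real.sin t) with hc
  have hcm : ∀ t, c t ∈ closedDisc p δ := circle_mem_closedDisc p δ
  set γ : ℝ → ℝ × ℝ := fun t => f (c t) with hγdef
  have hγ : Continuous γ := by
    have : Continuous c := by fun_prop
    exact hf.comp_continuous this hcm
  have cpos : ∀ t, 0 < Real.cos t → (γ t).1 = 0 → 0 < sR * (γ t).2 := fun t h =>
    hr _ (hcm t) (by simp only [hc]; nlinarith [mul_pos hδ h])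
  have cneg : ∀ t, Real.cos t < 0 → (γ t).1 = 0 → 0 < sL * (γ t).2 := fun t h =>
    hl _ (hcm t) (by simp only [hc]; nlinarith [mul_neg_of_pos_of_neg hδ h])
  have top : 0 < (γ (Real.pi / 2)).1 := ht _ (hcm _) (by simp [hc]) (by simp [hc, hδ])
  have cos_bot : Real.cos (3 * Real.pi / 2) = 0 := by
    rw [show 3 * Real.pi / 2 = Real.pi / 2 + Real.pi by ring, Real.cos_add_pi]; simp
  have sin_bot : Real.sin (3 * Real.pi / 2) = -1 := by
    rw [show 3 * Real.pi / 2 = Real.pi / 2 + Real.pi by ring, Real.sin_add_pi]; simp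
  have bot : (γ (3 * Real.pi / 2)).1 < 0 :=
    hb _ (hcm _) (by simp [hc, cos_bot]) (by simp [hc, sin_bot, hδ])
  set ρ : ℝ → ℝ := fun t => √((γ t).1 ^ 2 + (γ t).2 ^ 2) with hρ
  have norm_eq : ∀ {s : ℤ}, (s = 1 ∨ s = -1) → ∀ t,
      ‖(⟨s * (γ t).2, -(s * (γ t).1)⟩ : ℂ)‖ = ρ t := by
    intro s hs t
    rw [Complex.norm_eq_sqrt_sq_add_sq]
    rcases hs with rfl | rfl <;> simp [hρ, add_comm]
  have polar : ∀ {s : ℤ}, (s = 1 ∨ s = -1) → ∀ t,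
      γ t = (ρ t * Real.cos (slitArg s (γ t)), ρ t * Real.sin (slitArg s (γ t))) := by
    intro s hs t
    have := norm_mul_cos_sin_slitArg hs (γ t)
    rw [norm_eq hs] at this
    exact Prod.ext this.1.symm this.2.symm
  have ρpos : ∀ t ∈ Icc 0 (2 * Real.pi), 0 < ρ t := by
    have key : ∀ t, γ t ≠ 0 → 0 < ρ t := by
      intro t h
      apply Real.sqrt_pos.2
      by_contra hle
      apply h
      have h1 : (γ t).1 = 0 := by nlinarith [sq_nonneg (γ t).1, sq_nonneg (γ t).2]
      have h2 : (γ t).2 = 0 := by nlinarith [sq_nonneg (γ t).1, sq_nonneg (γ t).2]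
      exact Prod.ext h1 h2
    intro t _
    refine key t fun h => ?_
    rcases lt_trichotomy (Real.cos t) 0 with h0 | h0 | h0
    · simpa [h] using cneg t h0
    · have hs : Real.sin t = 1 ∨ Real.sin t = -1 := by
        have := Real.sin_sq_add_cos_sq t
        rw [h0] at this
        exact sq_eq_one_iff.1 (by linarith)
      rcases hs with hs | hs
      · have := ht _ (hcm t) (by simp [hc, h0]) (by simp [hc, hs, hδ])
        change 0 < (γ t).1 at this
        simp [h] at this
      · have := hb _ (hcm t) (by simp [hc, h0]) (by simp [hc, hs, hδ])
        change (γ t).1 < 0 at this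
        simp [h] at this
    · simpa [h] using cpos t h0
  have cont1 : ContinuousOn (fun t => slitArg sR (γ t)) (Icc 0 (Real.pi / 2)) := by
    refine continuousOn_slitArg_comp hR hγ.continuousOn fun t ht h0 => ?_
    rcases ht.2.eq_or_lt with h | h
    · rw [h] at h0; exact absurd h0 top.ne'
    · exact cpos t (Real.cos_pos_of_mem_Ioo ⟨by linarith [ht.1], h⟩) h0
  have cont2 : ContinuousOn (fun t => slitArg sL (γ t))
      (Icc (Real.pi / 2) (3 * Real.pi / 2)) := by
    refine continuousOn_slitArg_comp hL hγ.continuousOn fun t ht h0 => ?_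
    rcases ht.1.eq_or_lt with h | h
    · rw [← h] at h0; exact absurd h0 top.ne'
    rcases ht.2.eq_or_lt with h' | h'
    · rw [h'] at h0; exact absurd h0 bot.ne
    · exact cneg t (Real.cos_neg_of_pi_div_two_lt_of_lt h (by linarith)) h0
  -- The branches agree at the top of the circle but differ by `(sL - sR) * π = 2 * π * d` at the
  -- bottom; the last quarter carries this shift.
  have cont3 : ContinuousOn (fun t => slitArg sR (γ t) + 2 * Real.pi * d)
      (Icc (3 * Real.pi / 2) (2 * Real.pi)) := by
    refine ContinuousOn.add (continuousOn_slitArg_comp hR hγ.continuousOn fun t ht h0 => ?_)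
      continuousOn_const
    rcases ht.1.eq_or_lt with h | h
    · rw [← h] at h0; exact absurd h0 bot.ne
    · refine cpos t ?_ h0
      rw [← Real.cos_sub_two_pi]
      exact Real.cos_pos_of_mem_Ioo ⟨by linarith, by linarith [ht.2]⟩
  have glue1 : slitArg sR (γ (Real.pi / 2)) = slitArg sL (γ (Real.pi / 2)) :=
    slitArg_of_pos hR hL top
  have glue2 : slitArg sL (γ (3 * Real.pi / 2)) =
      slitArg sR (γ (3 * Real.pi / 2)) + 2 * Real.pi * d := by
    have h := slitArg_of_neg hL hR bot
    have hd' : (2 * d : ℝ) = sL - sR := by exact_mod_cast hd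
    linear_combination h - Real.pi * hd'
  set α : ℝ → ℝ := fun t => if t ≤ Real.pi / 2 then slitArg sR (γ t) else
    if t ≤ 3 * Real.pi / 2 then slitArg sL (γ t) else slitArg sR (γ t) + 2 * Real.pi * d with hα
  have e1 : EqOn α (fun t => slitArg sR (γ t)) (Icc 0 (Real.pi / 2)) := fun t ht => by
    simp [hα, ht.2]
  have e2 : EqOn α (fun t => slitArg sL (γ t)) (Icc (Real.pi / 2) (3 * Real.pi / 2)) := by
    intro t ht
    rcases ht.1.eq_or_lt with h | h
    · subst h; simp [hα, glue1]
    · simp [hα, ht.2, not_le.2 h]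
  have e3 : EqOn α (fun t => slitArg sR (γ t) + 2 * Real.pi * d)
      (Icc (3 * Real.pi / 2) (2 * Real.pi)) := by
    intro t ht
    have h1 : ¬ t ≤ Real.pi / 2 := by linarith [ht.1]
    rcases ht.1.eq_or_lt with h | h
    · rw [← h] at h1 ⊢
      simp only [hα, if_neg h1, le_refl, if_true, glue2]
    · simp [hα, h1, not_le.2 h]
  refine ⟨ρ, α, ?_, fun t ht => ⟨ρpos t ht, ?_⟩, ?_⟩
  · have hU : Icc 0 (2 * Real.pi) = (Icc 0 (Real.pi / 2) ∪
        Icc (Real.pi / 2) (3 * Real.pi / 2)) ∪ Icc (3 * Real.pi / 2) (2 * Real.pi) := by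
      rw [Icc_union_Icc_eq_Icc (by linarith) (by linarith),
        Icc_union_Icc_eq_Icc (by linarith) (by linarith)]
    rw [hU]
    exact ((cont1.congr e1).union_of_isClosed (cont2.congr e2) isClosed_Icc
      isClosed_Icc).union_of_isClosed (cont3.congr e3) (isClosed_Icc.union isClosed_Icc)
      isClosed_Icc
  · change γ t = _
    rcases le_total t (Real.pi / 2) with h | h
    · rw [e1 ⟨ht.1, h⟩]; exact polar hR t
    rcases le_total t (3 * Real.pi / 2) with h' | h'
    · rw [e2 ⟨h, h'⟩]; exact polar hL t
    · rw [e3 ⟨h', ht.2⟩]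
      have h1 := Real.cos_add_int_mul_two_pi (slitArg sR (γ t)) d
      have h2 := Real.sin_add_int_mul_two_pi (slitArg sR (γ t)) d
      rw [mul_comm (d : ℝ)] at h1 h2
      simp only [h1, h2]
      exact polar hR t
  · rw [e1 (left_mem_Icc.2 (by linarith)), e3 (right_mem_Icc.2 (by linarith))]
    have : γ (2 * Real.pi) = γ 0 := by simp [hγdef, hc]
    simp [this]

/-- Two continuous arguments of the same loop differ by `2 * π` times a continuous integer-valued
function, which is constant on an interval. -/
theorem HasDiscDegree.unique {f : ℝ × ℝ → ℝ × ℝ} {p : ℝ × ℝ} {δ : ℝ} {d d' : ℤ}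
    (h : HasDiscDegree f p δ d) (h' : HasDiscDegree f p δ d') : d = d' := by
  obtain ⟨-, ρ, α, hα, hpol, hd⟩ := h
  obtain ⟨-, ρ', α', hα', hpol', hd'⟩ := h'
  have hπ := Real.pi_pos
  have hcos : ∀ t ∈ Icc 0 (2 * Real.pi), ∃ n : ℤ, n * (2 * Real.pi) = α t - α' t := by
    intro t ht
    obtain ⟨hρ, he⟩ := hpol t ht
    obtain ⟨hρ', he'⟩ := hpol' t ht
    rw [he, Prod.mk.injEq] at he'
    obtain ⟨h1, h2⟩ := he'
    have hsq : ρ t ^ 2 = ρ' t ^ 2 := by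
      linear_combination (ρ t * Real.cos (α t) + ρ' t * Real.cos (α' t)) * h1 +
        (ρ t * Real.sin (α t) + ρ' t * Real.sin (α' t)) * h2 -
        ρ t ^ 2 * Real.sin_sq_add_cos_sq (α t) + ρ' t ^ 2 * Real.sin_sq_add_cos_sq (α' t)
    have hρρ : ρ t = ρ' t := by
      rwa [sq_eq_sq₀ hρ.le hρ'.le] at hsq
    rw [hρρ] at h1 h2
    have c := mul_left_cancel₀ hρ'.ne' h1
    have s := mul_left_cancel₀ hρ'.ne' h2
    refine (Real.cos_eq_one_iff _).1 ?_
    rw [Real.cos_sub, c, s]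
    nlinarith [Real.sin_sq_add_cos_sq (α' t)]
  choose! n hn using hcos
  have hnc : ContinuousOn n (Icc 0 (2 * Real.pi)) := by
    have : ContinuousOn (fun t => (n t : ℝ)) (Icc 0 (2 * Real.pi)) := by
      refine ((hα.sub hα').div_const (2 * Real.pi)).congr fun t ht => ?_
      rw [eq_div_iff (by positivity)]
      exact hn t ht
    exact Int.isClosedEmbedding_coe_real.isEmbedding.continuousOn_iff.2 this
  have h0 : (0 : ℝ) ∈ Icc 0 (2 * Real.pi) := left_mem_Icc.2 (by linarith)
  have h1 : 2 * Real.pi ∈ Icc 0 (2 * Real.pi) := right_mem_Icc.2 (by linarith)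
  have hconst := isPreconnected_Icc.constant hnc h0 h1
  have e0 := hn _ h0
  have e1 := hn _ h1
  rw [hconst] at e0
  have : 2 * Real.pi * (d : ℝ) = 2 * Real.pi * d' := by linarith
  exact_mod_cast mul_left_cancel₀ (by positivity) this

theorem HasFixedPointIndex.unique {f : ℝ × ℝ → ℝ × ℝ} {p : ℝ × ℝ} {d d' : ℤ}
    (h : HasFixedPointIndex f p d) (h' : HasFixedPointIndex f p d') : d = d' := by
  obtain ⟨δ, hδ, hδ'⟩ := (h.2.and h'.2).exists
  exact hδ.2.unique hδ'.2

/-! ### The zero graph and the signs along it -/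

/-- A continuous function which is increasing in the second variable, and negative on the lower
and positive on the upper side of a rectangle, vanishes along a continuous graph. -/
theorem exists_continuousOn_graph {u : ℝ × ℝ → ℝ} {I : Set ℝ} {c e : ℝ} (hce : c ≤ e)
    (hu : ContinuousOn u (I ×ˢ Icc c e))
    (hmono : ∀ x ∈ I, StrictMonoOn (fun r => u (x, r)) (Icc c e))
    (hc : ∀ x ∈ I, u (x, c) < 0) (he : ∀ x ∈ I, 0 < u (x, e)) :
    ∃ φ : ℝ → ℝ, ContinuousOn φ I ∧ (∀ x ∈ I, φ x ∈ Icc c e) ∧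
      ∀ x ∈ I, ∀ r ∈ Icc c e, u (x, r) = 0 ↔ r = φ x := by
  have hslice : ∀ r ∈ Icc c e, ContinuousOn (fun x => u (x, r)) I := fun r hr =>
    hu.comp (by fun_prop) fun x hx => ⟨hx, hr⟩
  have hex : ∀ x ∈ I, ∃ r ∈ Icc c e, u (x, r) = 0 := by
    intro x hx
    have hcont : ContinuousOn (fun r => u (x, r)) (Icc c e) :=
      hu.comp (by fun_prop) fun r hr => ⟨hx, hr⟩
    exact intermediate_value_Icc hce hcont ⟨(hc x hx).le, (he x hx).le⟩
  choose! φ hφ hφ0 using hex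
  refine ⟨φ, fun x hx => ?_, hφ, fun x hx r hr => ⟨fun h => ?_, fun h => h ▸ hφ0 x hx⟩⟩
  -- By monotonicity `φ y` lies above or below a level `b` according to the sign of `u (y, b)`, and
  -- a strict sign persists for `y` near `x`. Levels outside `[c, e]` are trivial.
  · rw [ContinuousWithinAt, tendsto_order]
    constructor
    · intro b hb
      rcases lt_or_ge b c with hbc | hbc
      · filter_upwards [self_mem_nhdsWithin] with y hy using hbc.trans_le (hφ y hy).1
      · have hbm : b ∈ Icc c e := ⟨hbc, hb.le.trans (hφ x hx).2⟩
        have hlt : u (x, b) < 0 := by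
          rw [← hφ0 x hx]; exact hmono x hx hbm (hφ x hx) hb
        filter_upwards [(hslice b hbm x hx).eventually_lt_const hlt, self_mem_nhdsWithin]
          with y hy hyI
        rw [← hφ0 y hyI] at hy
        exact ((hmono y hyI).lt_iff_lt hbm (hφ y hyI)).1 hy
    · intro b hb
      rcases lt_or_ge e b with hbe | hbe
      · filter_upwards [self_mem_nhdsWithin] with y hy using (hφ y hy).2.trans_lt hbe
      · have hbm : b ∈ Icc c e := ⟨(hφ x hx).1.trans hb.le, hbe⟩
        have hlt : 0 < u (x, b) := by
          rw [← hφ0 x hx]; exact hmono x hx (hφ x hx) hbm hb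
        filter_upwards [(hslice b hbm x hx).eventually_const_lt hlt, self_mem_nhdsWithin]
          with y hy hyI
        rw [← hφ0 y hyI] at hy
        exact ((hmono y hyI).lt_iff_lt (hφ y hyI) hbm).1 hy
  · exact (hmono x hx).injOn hr (hφ x hx) (h.trans (hφ0 x hx).symm)

/-- The sign is an integer so that it can select a branch `slitArg s` and enter the formula for the
degree. -/
theorem exists_sign_of_ne_zero {g : ℝ → ℝ} {I : Set ℝ} (hI : IsPreconnected I)
    (hg : ContinuousOn g I) (h0 : ∀ x ∈ I, g x ≠ 0) :
    ∃ s : ℤ, (s = 1 ∨ s = -1) ∧ ∀ x ∈ I, 0 < s * g x := by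
  by_cases h : ∃ x ∈ I, 0 < g x
  · obtain ⟨x, hx, hgx⟩ := h
    refine ⟨1, Or.inl rfl, fun y hy => ?_⟩
    by_contra! hle
    simp only [Int.cast_one, one_mul] at hle
    obtain ⟨z, hz, hz0⟩ := hI.intermediate_value hy hx hg ⟨hle, hgx.le⟩
    exact h0 z hz hz0
  · push Not at h
    refine ⟨-1, Or.inr rfl, fun y hy => ?_⟩
    have := (h y hy).lt_of_ne (h0 y hy)
    simpa using this

theorem isOpen_region {a : ℝ} {ψ : ℝ → EReal} (hψ : LowerSemicontinuous ψ) :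
    IsOpen (region a ψ) := by
  have h1 : IsOpen {p : ℝ × ℝ | a < p.2} := isOpen_lt continuous_const continuous_snd
  refine h1.inter (isOpen_iff_mem_nhds.2 fun p hp => ?_)
  obtain ⟨c, hc1, hc2⟩ := EReal.lt_iff_exists_real_btwn.1 hp
  have h2 : ∀ᶠ q : ℝ × ℝ in 𝓝 p, (c : EReal) < ψ q.1 :=
    continuous_fst.continuousAt.eventually (hψ p.1 c hc2)
  have h3 : ∀ᶠ q : ℝ × ℝ in 𝓝 p, q.2 < c :=
    continuous_snd.continuousAt.eventually_lt_const (EReal.coe_lt_coe_iff.1 hc1)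
  filter_upwards [h2, h3] with q hq1 hq2
  exact (EReal.coe_lt_coe_iff.2 hq2).trans hq1

theorem closedDisc_subset_prod {p : ℝ × ℝ} {δ η κ : ℝ} (hδ : 0 ≤ δ) (hη : δ ≤ η) (hκ : δ ≤ κ) :
    closedDisc p δ ⊆ Icc (p.1 - η) (p.1 + η) ×ˢ Icc (p.2 - κ) (p.2 + κ) := by
  intro q hq
  change (q.1 - p.1) ^ 2 + (q.2 - p.2) ^ 2 ≤ δ ^ 2 at hq
  have h1 := abs_le_of_sq_le_sq' (by nlinarith [sq_nonneg (q.2 - p.2)] :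
    (q.1 - p.1) ^ 2 ≤ δ ^ 2) hδ
  have h2 := abs_le_of_sq_le_sq' (by nlinarith [sq_nonneg (q.1 - p.1)] :
    (q.2 - p.2) ^ 2 ≤ δ ^ 2) hδ
  exact ⟨⟨by linarith, by linarith⟩, ⟨by linarith, by linarith⟩⟩

/-! ### Local index at an isolated zero -/

/-- The degree at an isolated zero of a planar map whose first component is increasing in the
second variable is `-1`, `0` or `1`. -/
theorem exists_eventually_hasDiscDegree {f : ℝ × ℝ → ℝ × ℝ} {p : ℝ × ℝ} {ε : ℝ} (hε : 0 < ε)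
    (hf : ContinuousOn f (Icc (p.1 - ε) (p.1 + ε) ×ˢ Icc (p.2 - ε) (p.2 + ε)))
    (hmono : ∀ x ∈ Icc (p.1 - ε) (p.1 + ε),
      StrictMonoOn (fun r => (f (x, r)).1) (Icc (p.2 - ε) (p.2 + ε)))
    (hp : f p = 0)
    (hiso : ∀ q ∈ Icc (p.1 - ε) (p.1 + ε) ×ˢ Icc (p.2 - ε) (p.2 + ε), f q = 0 → q = p) :
    ∃ d : ℤ, (d = -1 ∨ d = 0 ∨ d = 1) ∧ ∀ᶠ δ in 𝓝[>] (0 : ℝ), HasDiscDegree f p δ d := by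
  have hp1 : p.1 ∈ Icc (p.1 - ε) (p.1 + ε) := ⟨by linarith, by linarith⟩
  have hp2 : p.2 ∈ Icc (p.2 - ε) (p.2 + ε) := ⟨by linarith, by linarith⟩
  have hlo : p.2 - ε ∈ Icc (p.2 - ε) (p.2 + ε) := ⟨le_rfl, by linarith⟩
  have hup : p.2 + ε ∈ Icc (p.2 - ε) (p.2 + ε) := ⟨by linarith, le_rfl⟩
  have hf1 : ContinuousOn (fun q => (f q).1)
      (Icc (p.1 - ε) (p.1 + ε) ×ˢ Icc (p.2 - ε) (p.2 + ε)) := hf.fst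
  have hp01 : (f (p.1, p.2)).1 = 0 := by rw [Prod.mk.eta, hp]; rfl
  have htop : ∀ r, p.2 < r → r ≤ p.2 + ε → 0 < (f (p.1, r)).1 := fun r h1 h2 => by
    rw [← hp01]; exact hmono p.1 hp1 hp2 ⟨by linarith, h2⟩ h1
  have hbot : ∀ r, r < p.2 → p.2 - ε ≤ r → (f (p.1, r)).1 < 0 := fun r h1 h2 => by
    rw [← hp01]; exact hmono p.1 hp1 ⟨h2, by linarith⟩ hp2 h1
  have hnhds : Icc (p.1 - ε) (p.1 + ε) ∈ 𝓝 p.1 := Icc_mem_nhds (by linarith) (by linarith)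
  have hslice : ∀ r ∈ Icc (p.2 - ε) (p.2 + ε), ContinuousAt (fun x => (f (x, r)).1) p.1 :=
    fun r hr => ContinuousOn.continuousAt (s := Icc (p.1 - ε) (p.1 + ε))
      (hf1.comp (f := fun x => (x, r)) (by fun_prop) fun x hx => ⟨hx, hr⟩) hnhds
  -- Narrowing the strip keeps the signs at the bottom and top of the central vertical segment, so
  -- the zero graph exists over the whole strip.
  obtain ⟨η', hη', hball⟩ := Metric.eventually_nhds_iff.1
    (((hslice _ hlo).eventually_lt_const (hbot _ (by linarith) le_rfl)).and
      ((hslice _ hup).eventually_const_lt (htop _ (by linarith) le_rfl)))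
  obtain ⟨η, hη, hηη', hηε⟩ : ∃ η, 0 < η ∧ η < η' ∧ η < ε :=
    ⟨min η' ε / 2, by positivity, by linarith [min_le_left η' ε, lt_min hη' hε],
      by linarith [min_le_right η' ε, lt_min hη' hε]⟩
  have hsub : Icc (p.1 - η) (p.1 + η) ⊆ Icc (p.1 - ε) (p.1 + ε) :=
    Icc_subset_Icc (by linarith) (by linarith)
  have hends : ∀ x ∈ Icc (p.1 - η) (p.1 + η),
      (f (x, p.2 - ε)).1 < 0 ∧ 0 < (f (x, p.2 + ε)).1 := fun x hx => hball (by
    rw [Real.dist_eq, abs_lt]; constructor <;> linarith [hx.1, hx.2])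
  obtain ⟨φ, hφc, hφm, hφ⟩ := exists_continuousOn_graph (u := fun q => (f q).1)
    (I := Icc (p.1 - η) (p.1 + η)) (c := p.2 - ε) (e := p.2 + ε) (by linarith)
    (hf1.mono (prod_mono hsub subset_rfl)) (fun x hx => hmono x (hsub hx))
    (fun x hx => (hends x hx).1) (fun x hx => (hends x hx).2)
  have hgc : ContinuousOn (fun x => (f (x, φ x)).2) (Icc (p.1 - η) (p.1 + η)) :=
    hf.snd.comp (continuousOn_id.prodMk hφc) fun x hx => ⟨hsub hx, hφm x hx⟩
  have hg0 : ∀ x ∈ Icc (p.1 - η) (p.1 + η), x ≠ p.1 → (f (x, φ x)).2 ≠ 0 := by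
    intro x hx hne h
    have h1 : (f (x, φ x)).1 = 0 := (hφ x hx _ (hφm x hx)).2 rfl
    exact hne (congrArg Prod.fst (hiso (x, φ x) ⟨hsub hx, hφm x hx⟩ (Prod.ext h1 h)))
  have hIr : Ioc p.1 (p.1 + η) ⊆ Icc (p.1 - η) (p.1 + η) := fun x hx =>
    ⟨by linarith [hx.1], hx.2⟩
  have hIl : Ico (p.1 - η) p.1 ⊆ Icc (p.1 - η) (p.1 + η) := fun x hx =>
    ⟨hx.1, by linarith [hx.2]⟩
  obtain ⟨sR, hR, hsR⟩ := exists_sign_of_ne_zero isPreconnected_Ioc (hgc.mono hIr)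
    fun x hx => hg0 x (hIr hx) hx.1.ne'
  obtain ⟨sL, hL, hsL⟩ := exists_sign_of_ne_zero isPreconnected_Ico (hgc.mono hIl)
    fun x hx => hg0 x (hIl hx) hx.2.ne
  -- Both signs are `±1`, so their difference is even and at most `2` in absolute value.
  obtain ⟨d, hd, hd'⟩ : ∃ d : ℤ, 2 * d = sL - sR ∧ (d = -1 ∨ d = 0 ∨ d = 1) :=
    ⟨(sL - sR) / 2, by omega, by omega⟩
  refine ⟨d, hd', ?_⟩
  filter_upwards [Ioo_mem_nhdsGT hη] with δ hδ
  have hdisc := closedDisc_subset_prod (p := p) hδ.1.le hδ.2.le (hδ.2.trans hηε).le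
  refine hasDiscDegree_of_signs hδ.1 hL hR hd
    (hf.mono (hdisc.trans (prod_mono hsub subset_rfl))) ?_ ?_ ?_ ?_
  · intro q hq hlt h0
    have := hsR q.1 ⟨hlt, (hdisc hq).1.2⟩
    rwa [← (hφ q.1 (hdisc hq).1 q.2 (hdisc hq).2).1 h0] at this
  · intro q hq hlt h0
    have := hsL q.1 ⟨(hdisc hq).1.1, hlt⟩
    rwa [← (hφ q.1 (hdisc hq).1 q.2 (hdisc hq).2).1 h0] at this
  · intro q hq he hlt
    have := htop q.2 hlt (hdisc hq).2.2
    rwa [← he] at this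
  · intro q hq he hlt
    have := hbot q.2 hlt (hdisc hq).2.1
    rwa [← he] at this

/-! ### Application to the twist map -/

theorem translationT_zpow_apply (n : ℤ) (q : ℝ × ℝ) :
    (translationT ^ n) q = (q.1 + 2 * n * Real.pi, q.2) := by
  have h1 : ∀ q, translationT q = (q.1 + 2 * Real.pi, q.2) := fun q => by
    ext <;> simp [translationT]
  have h2 : ∀ q, translationT⁻¹ q = (q.1 - 2 * Real.pi, q.2) := fun q => by
    rw [Equiv.Perm.inv_eq_iff_eq, h1]
    ext <;> simp
  induction n generalizing q with
  | zero => simp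
  | succ n ih =>
    rw [zpow_add_one, Equiv.Perm.mul_apply, ih, h1]
    ext <;> push_cast <;> ring
  | pred n ih =>
    rw [zpow_sub_one, Equiv.Perm.mul_apply, ih, h2]
    ext <;> push_cast <;> ring

theorem corollary2p9
    (a : ℝ) (ψ : ℝ → EReal)
    (hψa : ∀ θ : ℝ, (a : EReal) < ψ θ)
    (hψper : ∀ θ : ℝ, ψ (θ + 2 * Real.pi) = ψ θ)
    (hψlsc : LowerSemicontinuous ψ)
    (F G : ℝ × ℝ → ℝ)
    (hF : ContDiffOn ℝ 2 F (region a ψ))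
    (hG : ContDiffOn ℝ 2 G (region a ψ))
    (hlift : IsCylinderLift (region a ψ) F G)
    (hexact : IsExactSymplectic (region a ψ) F G)
    (htwist : IsTwist (region a ψ) F)
    -- `F (θ, a)` is the boundary value of `F` at `r = a`
    (hFa : ∀ θ : ℝ, Tendsto (fun r : ℝ => F (θ, r)) (𝓝[>] a) (𝓝 (F (θ, a))))
    (N : ℤ)
    (hcond : ∀ θ : ℝ, ∃ r : ℝ, a < r ∧ (r : EReal) < ψ θ ∧
      F (θ, a) < θ + 2 * N * Real.pi ∧ θ + 2 * N * Real.pi < F (θ, r))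
    (p : ℝ × ℝ)
    (hp : IsIsolatedPointOf (solutionSet (region a ψ) F G N) p) :
    -- the index `i(T⁻ᴺ S, p)` is well defined, and it is `-1`, `0` or `1`
    ∃ d : ℤ, (d = -1 ∨ d = 0 ∨ d = 1) ∧
      ∀ i : ℤ, HasFixedPointIndex
        (⇑(translationT ^ (-N)) ∘ fun q : ℝ × ℝ => (F q, G q)) p i ↔ i = d := by

  have hopen := isOpen_region (a := a) hψlsc
  obtain ⟨⟨hpΩ, hpF, hpG⟩, ε₁, hε₁, hiso⟩ := hp
  obtain ⟨ε₂, hε₂, hball⟩ := Metric.isOpen_iff.1 hopen p hpΩ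
  -- Strict inequalities let the closed square of half-side `ε`, a closed ball of the product
  -- metric, fit in both open balls.
  obtain ⟨ε, hε, hεε₁, hεε₂⟩ : ∃ ε, 0 < ε ∧ ε < ε₁ ∧ ε < ε₂ :=
    ⟨min ε₁ ε₂ / 2, by positivity, by linarith [min_le_left ε₁ ε₂, lt_min hε₁ hε₂],
      by linarith [min_le_right ε₁ ε₂, lt_min hε₁ hε₂]⟩
  have hdist : ∀ q ∈ Icc (p.1 - ε) (p.1 + ε) ×ˢ Icc (p.2 - ε) (p.2 + ε), dist q p ≤ ε := by
    intro q hq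
    rw [Prod.dist_eq, max_le_iff, Real.dist_eq, Real.dist_eq, abs_le, abs_le]
    exact ⟨⟨by linarith [hq.1.1], by linarith [hq.1.2]⟩,
      ⟨by linarith [hq.2.1], by linarith [hq.2.2]⟩⟩
  have hbox : Icc (p.1 - ε) (p.1 + ε) ×ˢ Icc (p.2 - ε) (p.2 + ε) ⊆ region a ψ :=
    fun q hq => hball ((hdist q hq).trans_lt hεε₂)
  set P : ℝ × ℝ → ℝ × ℝ := ⇑(translationT ^ (-N)) ∘ fun q : ℝ × ℝ => (F q, G q) with hP
  have hPq : ∀ q, P q = (F q - 2 * N * Real.pi, G q) := fun q => by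
    simp only [hP, Function.comp, translationT_zpow_apply]
    push_cast
    ext <;> simp
    ring
  have hfix : ∀ q ∈ Icc (p.1 - ε) (p.1 + ε) ×ˢ Icc (p.2 - ε) (p.2 + ε), P q = q → q = p := by
    intro q hq h
    rw [hPq] at h
    have h1 := congrArg Prod.fst h
    have h2 := congrArg Prod.snd h
    simp only at h1 h2
    exact hiso q ⟨hbox hq, by linarith, h2⟩ ((hdist q hq).trans_lt hεε₁)
  have hpfix : P p = p := by
    rw [hPq, hpF, hpG]
    ext <;> simp
  have hFc := hF.continuousOn.mono hbox
  have hGc := hG.continuousOn.mono hbox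
  obtain ⟨d, hd, hdeg⟩ := exists_eventually_hasDiscDegree (f := fun q => P q - q) (p := p) hε
    (by
      simp only [hPq]
      exact ((hFc.sub continuousOn_const).prodMk hGc).sub continuousOn_id)
    -- On a vertical segment the first component is `F` minus a constant, so the twist condition
    -- applies directly.
    (by
      intro x hx
      have hm : StrictMonoOn (fun r => F (x, r)) (Icc (p.2 - ε) (p.2 + ε)) := by
        refine strictMonoOn_of_deriv_pos (convex_Icc _ _)
          (hFc.comp (by fun_prop) fun r hr => ⟨hx, hr⟩) fun r hr => ?_
        exact htwist (x, r) (hbox ⟨hx, interior_subset hr⟩)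
      intro r hr r' hr' hlt
      have := hm hr hr' hlt
      simp only [hPq, Prod.fst_sub] at this ⊢
      linarith)
    (sub_eq_zero.2 hpfix) (fun q hq h => hfix q hq (sub_eq_zero.1 h))
  have hindex : HasFixedPointIndex P p d := by
    refine ⟨hpfix, ?_⟩
    filter_upwards [hdeg, Ioo_mem_nhdsGT hε] with δ h hδ
    exact ⟨fun q hq => hfix q (closedDisc_subset_prod hδ.1.le hδ.2.le hδ.2.le hq), h⟩
  exact ⟨d, hd, fun i => ⟨fun hi => hi.unique hindex, fun hi => hi ▸ hindex⟩⟩
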